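/- Let $\sigma>0$, let $f_\theta(y)=\frac{1}{\sqrt{2\pi\sigma^2}}e^{-(y-\theta)^2/(2\sigma^2)}$ be the $\mathcal N(\theta,\sigma^2)$ density, and let $\pi$ be a positive Radon measure on $\mathbb R$ (a possibly improper prior), not concentrated at a single point, such that the marginal likelihood $f(y)=\int_{\mathbb R} f_\theta(y)\,\pi(d\theta)$ satisfies $0<f(y)<\infty$ for all $y\in\mathbb R$. For $\alpha\in(0,1)$ and $\theta_0\in\mathbb R$ let $$A_\alpha(\theta_0)=\Big\{y\in\mathbb R : \log\frac{f(y)}{f_{\theta_0}(y)}\le k_\alpha(\theta_0)\Big\},$$ where $k_\alpha(\theta_0)$ is the smallest real number for which $\Pr(Y\in A_\alpha(\theta_0))=1-\alpha$ when $Y\sim\mathcal N(\theta_0,\sigma^2)$. The FAB confidence region is $C_\alpha(y)=\{\theta_0\in\mathbb R : y\in A_\alpha(\theta_0)\}$, and the FAB focal point $\widehat\theta^{\mathrm{FAB}}(y)$ is the unique element of $\bigcap_{\alpha\in(0,1)}C_\alpha(y)$. Assume that there are constants $\delta\ge 0$ and $\gamma>0$ such that $f(y)\sim\gamma|y|^{-\delta}$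 as $y\to+\infty$ and as $y\to-\infty$ (the quotient of the two sides tends to $1$). Then these objects are well defined ($k_\alpha(\theta_0)$ exists for all $\alpha\in(0,1)$ and $\theta_0\in\mathbb R$, and $\bigcap_{\alpha\in(0,1)}C_\alpha(y)$ is a singleton for every $y\in\mathbb R$), the influence of the prior on the focal point vanishes, $$\lim_{y\to\pm\infty}\big(\widehat\theta^{\mathrm{FAB}}(y)-y\big)=0,$$ and, for every $\alpha\in(0,1)$, the sets $C_\alpha(y)$ are closed and $$\lim_{y\to\pm\infty}\big(C_\alpha(y)-y\big)=\big[-\sigma\Phi^{-1}(1-\alpha/2),\ \sigma\Phi^{-1}(1-\alpha/2)\big]$$ in Hausdorff distance, where $C-y=\{x-y : x\in C\}$ and $\Phi^{-1}$ is the quantile function of the standard normal distribution. -/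

import Mathlib

open MeasureTheory ProbabilityTheory Filter Topology
open scoped ENNReal NNReal

namespace FAB

noncomputable section

/-- The variance `σ²` as a nonnegative real. -/
def variance (σ : ℝ) : ℝ≥0 := ⟨σ ^ 2, sq_nonneg σ⟩

/-- The Gaussian likelihood `f_θ(y)`, i.e. the density of `N(θ, σ²)` at `y`. -/
def likelihood (σ θ y : ℝ) : ℝ := gaussianPDFReal θ (variance σ) y

/-- The marginal likelihood `f(y) = ∫ f_θ(y) π(dθ)`. -/
def marginal (σ : ℝ) (π : Measure ℝ) (y : ℝ) : ℝ := ∫ θ, likelihood σ θ y ∂π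

/-- The standing assumption on the (possibly improper) prior: it is a Radon measure on `ℝ`
(on `ℝ` this means a locally finite Borel measure), it is not concentrated at a single point, and
`0 < ∫ f_θ(y) π(dθ) < ∞` for every `y`. -/
structure IsAdmissiblePrior (σ : ℝ) (π : Measure ℝ) : Prop where
  locallyFinite : IsLocallyFiniteMeasure π
  nondegenerate : ∀ t : ℝ, π {t}ᶜ ≠ 0
  marginal_pos : ∀ y : ℝ, 0 < ∫⁻ θ, ENNReal.ofReal (likelihood σ θ y) ∂π
  marginal_lt_top : ∀ y : ℝ, ∫⁻ θ, ENNReal.ofReal (likelihood σ θ y) ∂π < ∞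

/-- `f(y) ∼ γ |y|^{-δ} exp(-(κ/σ)|y|)` as `y → ±∞`, for some `δ ≥ 0` and `γ > 0`, where `∼` means
that the quotient tends to `1`. -/
def HasTails (σ κ : ℝ) (f : ℝ → ℝ) : Prop :=
  ∃ δ γ : ℝ, 0 ≤ δ ∧ 0 < γ ∧
    Tendsto (fun y => f y / (γ * |y| ^ (-δ) * Real.exp (-(κ / σ) * |y|))) atTop (𝓝 1) ∧
    Tendsto (fun y => f y / (γ * |y| ^ (-δ) * Real.exp (-(κ / σ) * |y|))) atBot (𝓝 1)

/-- The log-likelihood ratio `λ_{θ₀}(y) = log (f(y) / f_{θ₀}(y))`. -/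
def logRatio (σ : ℝ) (π : Measure ℝ) (θ₀ y : ℝ) : ℝ :=
  Real.log (marginal σ π y / likelihood σ θ₀ y)

/-- The thresholds `k` for which the test region `{y | λ_{θ₀}(y) ≤ k}` has probability exactly
`1 - α` under `Y ∼ N(θ₀, σ²)`. -/
def exactThresholds (σ : ℝ) (π : Measure ℝ) (α θ₀ : ℝ) : Set ℝ :=
  {k | (gaussianReal θ₀ (variance σ)).real {y | logRatio σ π θ₀ y ≤ k} = 1 - α}

/-- `k_α(θ₀)`, the smallest threshold with exact coverage `1 - α`. -/
def threshold (σ : ℝ) (π : Measure ℝ) (α θ₀ : ℝ) : ℝ := sInf (exactThresholds σ π α θ₀)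

/-- The acceptance region `A_α(θ₀)` of the most powerful test. -/
def acceptanceRegion (σ : ℝ) (π : Measure ℝ) (α θ₀ : ℝ) : Set ℝ :=
  {y | logRatio σ π θ₀ y ≤ threshold σ π α θ₀}

/-- The FAB confidence region `C_α(y) = {θ₀ | y ∈ A_α(θ₀)}`. -/
def confidenceRegion (σ : ℝ) (π : Measure ℝ) (α y : ℝ) : Set ℝ :=
  {θ₀ | y ∈ acceptanceRegion σ π α θ₀}

/-- The intersection of all confidence regions `C_α(y)`, `α ∈ (0, 1)`. -/
def focalSet (σ : ℝ) (π : Measure ℝ) (y : ℝ) : Set ℝ :=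
  ⋂ α ∈ Set.Ioo (0 : ℝ) 1, confidenceRegion σ π α y

/-- The FAB focal point: the point of the intersection of all confidence regions, when this
intersection is a singleton. -/
def focalPoint (σ : ℝ) (π : Measure ℝ) (y : ℝ) : ℝ :=
  Classical.epsilon fun t => focalSet σ π y = {t}

/-- The quantile function `Φ⁻¹` of the standard normal distribution (meaningful on `(0, 1)`). -/
def normalQuantile (p : ℝ) : ℝ := sInf {x | p ≤ cdf (gaussianReal 0 1) x}

/-- The translate `C - y`. -/
def shiftBack (C : Set ℝ) (y : ℝ) : Set ℝ := (fun t => t - y) '' C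

/-- The centred `z`-interval `[-σ Φ⁻¹(1 - α/2), σ Φ⁻¹(1 - α/2)]`. -/
def zInterval (σ α : ℝ) : Set ℝ :=
  Set.Icc (-(σ * normalQuantile (1 - α / 2))) (σ * normalQuantile (1 - α / 2))

end

end FAB

/-! For fixed `θ`, the ratio `f(y) / f_θ(y)` is a mixture of exponentials in `y`: the quadratic
terms cancel. It is therefore smooth and strictly convex, as the prior is not a point mass. Its
level sets have at most two points, so the threshold exists and is unique, and `θ ∈ C_α(y)` becomes
`lowerProb σ π θ y ≤ 1 - α`, with no threshold left (`mem_confidenceRegion_iff`). Letting `α → 1`,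
the focal points are the `θ` whose ratio is minimal at `y`; the zero-derivative equation has exactly
one solution.

Power tails give `f(y + h) / f(y) → 1`. Testing minimality at `y ± h` then pins the focal point to
within `h` of `y`. Likewise the ratio at `θ + u`, divided by its value at `θ`, tends to `exp(u² /
(2σ²))` as `|θ| → ∞`, so distances from `θ` eventually order the ratios. Convexity turns this
comparison at four points `θ ± r`, `θ ± r'` into inclusions of whole sublevel sets, uniformly in
`y`. Hence a large `θ` is accepted or rejected essentially as in the `z`-test. Bounded `θ` are
eventually rejected because the Gaussian factor beats the decay of `f`. -/

namespace FAB

/-! ### The likelihood ratio: smoothness and strict convexity -/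

section Likelihood

variable {σ : ℝ} {π : Measure ℝ}

lemma variance_ne_zero (hσ : 0 < σ) : variance σ ≠ 0 := by
  intro h
  have : σ ^ 2 = 0 := congrArg NNReal.toReal h
  exact hσ.ne' (by simpa using this)

lemma likelihood_eq (σ θ y : ℝ) :
    likelihood σ θ y =
      (√(2 * Real.pi * σ ^ 2))⁻¹ * Real.exp (-(y - θ) ^ 2 / (2 * σ ^ 2)) := rfl

lemma likelihood_pos (hσ : 0 < σ) (θ y : ℝ) : 0 < likelihood σ θ y :=
  gaussianPDFReal_pos _ _ _ (variance_ne_zero hσ)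

lemma continuous_likelihood (σ y : ℝ) : Continuous fun θ => likelihood σ θ y := by
  simp only [likelihood_eq]
  fun_prop

lemma IsAdmissiblePrior.integrable_likelihood (hσ : 0 < σ) (hπ : IsAdmissiblePrior σ π) (y : ℝ) :
    Integrable (fun θ => likelihood σ θ y) π := by
  refine ⟨(continuous_likelihood σ y).aestronglyMeasurable, ?_⟩
  rw [hasFiniteIntegral_iff_ofReal (ae_of_all _ fun θ => (likelihood_pos hσ θ y).le)]
  exact hπ.marginal_lt_top y

lemma IsAdmissiblePrior.marginal_pos' (hσ : 0 < σ) (hπ : IsAdmissiblePrior σ π) (y : ℝ) :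
    0 < marginal σ π y := by
  rw [marginal, integral_eq_lintegral_of_nonneg_ae
    (ae_of_all _ fun θ => (likelihood_pos hσ θ y).le)
    (continuous_likelihood σ y).aestronglyMeasurable]
  exact ENNReal.toReal_pos (hπ.marginal_pos y).ne' (hπ.marginal_lt_top y).ne

/-- The likelihood ratio `f(y) / f_θ(y)`. -/
noncomputable def ratio (σ : ℝ) (π : Measure ℝ) (θ y : ℝ) : ℝ :=
  marginal σ π y / likelihood σ θ y

lemma ratio_pos (hσ : 0 < σ) (hπ : IsAdmissiblePrior σ π) (θ y : ℝ) : 0 < ratio σ π θ y :=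
  div_pos (hπ.marginal_pos' hσ y) (likelihood_pos hσ θ y)

lemma ratio_eq (σ : ℝ) (π : Measure ℝ) (θ y : ℝ) :
    ratio σ π θ y =
      √(2 * Real.pi * σ ^ 2) * (marginal σ π y * Real.exp ((y - θ) ^ 2 / (2 * σ ^ 2))) := by
  rw [ratio, likelihood_eq, div_eq_mul_inv, mul_inv, inv_inv, ← Real.exp_neg, neg_div, neg_neg]
  ring

/-- The `y²` terms of the two Gaussian exponents cancel, so `y` enters only linearly in the
exponent. -/
lemma ratio_eq_integral (hσ : 0 < σ) (π : Measure ℝ) (θ₀ y : ℝ) :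
    ratio σ π θ₀ y =
      ∫ θ, Real.exp ((θ₀ ^ 2 - θ ^ 2) / (2 * σ ^ 2)) * Real.exp (y * ((θ - θ₀) / σ ^ 2)) ∂π := by
  rw [ratio, marginal, div_eq_mul_inv, ← integral_mul_const]
  congr 1
  ext θ
  rw [← Real.exp_add, likelihood_eq, likelihood_eq, mul_inv, inv_inv, ← Real.exp_neg]
  have : √(2 * Real.pi * σ ^ 2) ≠ 0 := by positivity
  rw [mul_mul_mul_comm, inv_mul_cancel₀ this, one_mul, ← Real.exp_add]
  congr 1
  field_simp
  ring

lemma integrable_ratio (hσ : 0 < σ) (hπ : IsAdmissiblePrior σ π) (θ₀ y : ℝ) :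
    Integrable (fun θ => Real.exp ((θ₀ ^ 2 - θ ^ 2) / (2 * σ ^ 2)) *
      Real.exp (y * ((θ - θ₀) / σ ^ 2))) π := by
  refine ((hπ.integrable_likelihood hσ y).mul_const (likelihood σ θ₀ y)⁻¹).congr
    (ae_of_all _ fun θ => ?_)
  have : √(2 * Real.pi * σ ^ 2) ≠ 0 := by positivity
  simp only
  rw [← Real.exp_add, likelihood_eq, likelihood_eq, mul_inv, inv_inv, ← Real.exp_neg,
    mul_mul_mul_comm, inv_mul_cancel₀ this, one_mul, ← Real.exp_add]
  congr 1
  field_simp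
  ring

/-- The marginal likelihood is a Gaussian factor times a moment generating function. -/
lemma differentiable_marginal (hσ : 0 < σ) (hπ : IsAdmissiblePrior σ π) :
    Differentiable ℝ (marginal σ π) := by
  set ν : Measure ℝ := π.withDensity fun θ => ENNReal.ofReal (Real.exp (-θ ^ 2 / (2 * σ ^ 2)))
    with hν
  have hdens : Measurable fun θ : ℝ => ENNReal.ofReal (Real.exp (-θ ^ 2 / (2 * σ ^ 2))) := by
    fun_prop
  have hint : ∀ t, Integrable (fun θ => Real.exp (t * θ)) ν := by
    intro t
    rw [hν, integrable_withDensity_iff_integrable_smul' hdens (by simp)]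
    refine (integrable_ratio hσ hπ 0 (t * σ ^ 2)).congr (ae_of_all _ fun θ => ?_)
    simp only [ENNReal.toReal_ofReal (Real.exp_pos _).le, smul_eq_mul]
    congr 2
    · ring
    · field_simp
      ring
  -- Finiteness of the marginal at every `y` makes all exponential moments finite, so every point is
  -- interior to the domain of the moment generating function.
  have hset : integrableExpSet id ν = Set.univ := Set.eq_univ_of_forall hint
  have hmgf : ∀ y, ratio σ π 0 y = mgf id ν (y / σ ^ 2) := by
    intro y
    rw [ratio_eq_integral hσ, mgf, hν, integral_withDensity_eq_integral_toReal_smul hdens (by simp)]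
    congr 1
    ext θ
    simp only [ENNReal.toReal_ofReal (Real.exp_pos _).le, smul_eq_mul, id]
    congr 2
    · ring
    · ring
  have hd : Differentiable ℝ (mgf id ν) := fun t => differentiableAt_mgf (by simp [hset])
  have heq : marginal σ π = fun y => mgf id ν (y / σ ^ 2) * likelihood σ 0 y := by
    ext y
    rw [← hmgf, ratio, div_mul_cancel₀ _ (likelihood_pos hσ 0 y).ne']
  rw [heq]
  refine (hd.comp (differentiable_id.div_const _)).mul ?_
  simp only [funext fun y => likelihood_eq σ 0 y]
  fun_prop

lemma continuous_ratio (hσ : 0 < σ) (hπ : IsAdmissiblePrior σ π) :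
    Continuous fun p : ℝ × ℝ => ratio σ π p.1 p.2 := by
  have := (differentiable_marginal hσ hπ).continuous
  simp only [ratio_eq]
  fun_prop

lemma strictConvexOn_ratio (hσ : 0 < σ) (hπ : IsAdmissiblePrior σ π) (θ₀ : ℝ) :
    StrictConvexOn ℝ Set.univ (ratio σ π θ₀) := by
  refine ⟨convex_univ, ?_⟩
  intro x _ y _ hxy a b ha hb hab
  simp only [smul_eq_mul]
  have hpt : ∀ θ, θ ≠ θ₀ →
      Real.exp ((a * x + b * y) * ((θ - θ₀) / σ ^ 2)) <
        a * Real.exp (x * ((θ - θ₀) / σ ^ 2)) + b * Real.exp (y * ((θ - θ₀) / σ ^ 2)) := by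
    intro θ hθ
    have hu : (θ - θ₀) / σ ^ 2 ≠ 0 := div_ne_zero (sub_ne_zero.2 hθ) (by positivity)
    have := strictConvexOn_exp.2 (Set.mem_univ (x * ((θ - θ₀) / σ ^ 2)))
      (Set.mem_univ (y * ((θ - θ₀) / σ ^ 2))) (fun h => hxy (mul_right_cancel₀ hu h)) ha hb hab
    simp only [smul_eq_mul] at this
    rwa [← mul_assoc, ← mul_assoc, ← add_mul] at this
  have hI := integrable_ratio hσ hπ θ₀
  have h1 : Integrable (fun θ => a * (Real.exp ((θ₀ ^ 2 - θ ^ 2) / (2 * σ ^ 2)) *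
      Real.exp (x * ((θ - θ₀) / σ ^ 2))) + b * (Real.exp ((θ₀ ^ 2 - θ ^ 2) / (2 * σ ^ 2)) *
      Real.exp (y * ((θ - θ₀) / σ ^ 2)))) π := ((hI x).const_mul a).add ((hI y).const_mul b)
  rw [← sub_pos, ratio_eq_integral hσ, ratio_eq_integral hσ, ratio_eq_integral hσ,
    ← integral_const_mul, ← integral_const_mul, ← integral_add ((hI x).const_mul a)
    ((hI y).const_mul b), ← integral_sub h1 (hI _)]
  have hform : ∀ θ, θ ≠ θ₀ → 0 < (a * (Real.exp ((θ₀ ^ 2 - θ ^ 2) / (2 * σ ^ 2)) *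
      Real.exp (x * ((θ - θ₀) / σ ^ 2))) + b * (Real.exp ((θ₀ ^ 2 - θ ^ 2) / (2 * σ ^ 2)) *
      Real.exp (y * ((θ - θ₀) / σ ^ 2)))) - Real.exp ((θ₀ ^ 2 - θ ^ 2) / (2 * σ ^ 2)) *
      Real.exp ((a * x + b * y) * ((θ - θ₀) / σ ^ 2)) := by
    intro θ hθ
    have := mul_pos (Real.exp_pos ((θ₀ ^ 2 - θ ^ 2) / (2 * σ ^ 2))) (sub_pos.2 (hpt θ hθ))
    linarith
  -- The convexity gap is strict except at `θ = θ₀`, where the exponential is constant in `y`; the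
  -- complement of `θ₀` has positive prior mass.
  refine (integral_pos_iff_support_of_nonneg (fun θ => ?_) (h1.sub (hI _))).2
    ((pos_iff_ne_zero.2 (hπ.nondegenerate θ₀)).trans_le
      (measure_mono fun θ hθ => (hform θ hθ).ne'))
  by_cases hθ : θ = θ₀
  · subst hθ
    simp [hab]
  · exact (hform θ hθ).le

end Likelihood

/-! ### Sublevel sets of a continuous function and exact coverage -/

section Coverage

variable {P : Measure ℝ} {g : ℝ → ℝ}

lemma exists_le_of_measureReal_sublevel_pos {k : ℝ} (h : 0 < P.real {x | g x ≤ k}) :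
    ∃ x, g x ≤ k := by
  by_contra! hc
  have : {x | g x ≤ k} = ∅ := Set.eq_empty_of_forall_notMem fun x hx => (hc x).not_ge hx
  simp [this] at h

variable [IsProbabilityMeasure P]

lemma continuous_cdf_of_nullSingleton [NullSingletonClass P] : Continuous (cdf P) := by
  refine continuous_iff_continuousAt.2 fun x => ?_
  rw [(cdf P).mono.continuousAt_iff_leftLim_eq_rightLim, StieltjesFunction.rightLim_eq]
  have h : (cdf P).measure {x} = 0 := by
    rw [measure_cdf]
    exact measure_singleton x
  rw [StieltjesFunction.measure_singleton, ENNReal.ofReal_eq_zero, sub_nonpos] at h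
  exact le_antisymm ((cdf P).mono.leftLim_le le_rfl) h

lemma exists_cdf_eq [NullSingletonClass P] {p : ℝ} (hp : p ∈ Set.Ioo (0 : ℝ) 1) :
    ∃ x, cdf P x = p :=
  mem_range_of_exists_le_of_exists_ge continuous_cdf_of_nullSingleton
    (((tendsto_cdf_atBot P).eventually_le_const hp.1).exists)
    (((tendsto_cdf_atTop P).eventually_const_le hp.2).exists)

/-- Null level sets mean that the law of `g` has no atoms, so its distribution function is
continuous and takes every value in `(0, 1)`. -/
lemma exists_measureReal_sublevel_eq (hg : Continuous g) (hnull : ∀ c, P {x | g x = c} = 0)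
    {p : ℝ} (hp : p ∈ Set.Ioo (0 : ℝ) 1) : ∃ k, P.real {x | g x ≤ k} = p := by
  have := Measure.isProbabilityMeasure_map (μ := P) hg.aemeasurable
  have : NullSingletonClass (P.map g) :=
    ⟨fun c => by rw [Measure.map_apply hg.measurable (measurableSet_singleton c)]; exact hnull c⟩
  obtain ⟨k, hk⟩ := exists_cdf_eq (P := P.map g) hp
  refine ⟨k, ?_⟩
  rw [cdf_eq_real, map_measureReal_apply hg.measurable measurableSet_Iic] at hk
  exact hk

lemma exists_gt_of_measureReal_sublevel_lt_one {k : ℝ} (h : P.real {x | g x ≤ k} < 1) :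
    ∃ x, k < g x := by
  by_contra! hc
  have : {x | g x ≤ k} = Set.univ := Set.eq_univ_of_forall hc
  simp [this] at h

/-- Between two values of a continuous function there is an open set of positive measure. -/
lemma measureReal_sublevel_lt [P.IsOpenPosMeasure] (hg : Continuous g) {k c : ℝ} (hkc : k < c)
    (h₀ : ∃ x, g x ≤ k) (h₁ : ∃ x, c ≤ g x) :
    P.real {x | g x ≤ k} < P.real {x | g x < c} := by
  obtain ⟨x, hx⟩ := h₀
  obtain ⟨y, hy⟩ := h₁
  have hopen : IsOpen {x | k < g x ∧ g x < c} :=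
    (isOpen_lt continuous_const hg).inter (isOpen_lt hg continuous_const)
  obtain ⟨z, hz⟩ : (k + c) / 2 ∈ Set.range g :=
    mem_range_of_exists_le_of_exists_ge hg ⟨x, by linarith⟩ ⟨y, by linarith⟩
  have hpos : 0 < P.real {x | k < g x ∧ g x < c} := by
    exact ENNReal.toReal_pos (hopen.measure_pos P
      ⟨z, by rw [hz]; linarith, by rw [hz]; linarith⟩).ne' (measure_ne_top P _)
  have hdisj : Disjoint {x | g x ≤ k} {x | k < g x ∧ g x < c} :=
    Set.disjoint_left.2 fun x hx hx' => hx'.1.not_ge hx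
  calc P.real {x | g x ≤ k} < P.real {x | g x ≤ k} + P.real {x | k < g x ∧ g x < c} := by linarith
    _ = P.real ({x | g x ≤ k} ∪ {x | k < g x ∧ g x < c}) :=
      (measureReal_union hdisj hopen.measurableSet).symm
    _ ≤ P.real {x | g x < c} := measureReal_mono (by
      rintro x (hx | hx)
      · exact lt_of_le_of_lt hx hkc
      · exact hx.2)

lemma sublevel_threshold_unique [P.IsOpenPosMeasure] (hg : Continuous g) {p : ℝ}
    (hp : p ∈ Set.Ioo (0 : ℝ) 1) {k c : ℝ} (hk : P.real {x | g x ≤ k} = p)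
    (hc : P.real {x | g x ≤ c} = p) : k = c := by
  have key : ∀ k c, P.real {x | g x ≤ k} = p → P.real {x | g x ≤ c} = p → ¬ k < c := by
    intro k c hk hc hlt
    have h₀ := exists_le_of_measureReal_sublevel_pos (P := P) (g := g) (k := k) (hk ▸ hp.1)
    obtain ⟨x, hx⟩ := exists_gt_of_measureReal_sublevel_lt_one (P := P) (g := g) (k := c)
      (hc ▸ hp.2)
    have := measureReal_sublevel_lt (P := P) hg hlt h₀ ⟨x, hx.le⟩
    have h2 : P.real {x | g x < c} ≤ P.real {x | g x ≤ c} :=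
      measureReal_mono fun x (hx : g x < c) => hx.le
    linarith
  exact le_antisymm (not_lt.1 (key c k hc hk)) (not_lt.1 (key k c hk hc))

/-- Eliminates the threshold: acceptance depends only on the probability of values strictly below
the observed one. -/
lemma le_threshold_iff [P.IsOpenPosMeasure] (hg : Continuous g) {p : ℝ}
    (hp : p ∈ Set.Ioo (0 : ℝ) 1) {k : ℝ} (hk : P.real {x | g x ≤ k} = p) (y : ℝ) :
    g y ≤ k ↔ P.real {x | g x < g y} ≤ p := by
  constructor
  · intro h
    rw [← hk]
    exact measureReal_mono fun x (hx : g x < g y) => (hx.trans_le h).le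
  · intro h
    by_contra! hlt
    have h₀ := exists_le_of_measureReal_sublevel_pos (P := P) (g := g) (k := k) (hk ▸ hp.1)
    have := measureReal_sublevel_lt (P := P) hg hlt h₀ ⟨y, le_rfl⟩
    linarith

/-- Three points on one level would contradict strict convexity at the middle one. -/
lemma countable_level_of_strictConvexOn (hg : StrictConvexOn ℝ Set.univ g) (c : ℝ) :
    {x | g x = c}.Countable := by
  have key : ∀ x y z, x < y → y < z → g x = c → g y = c → g z = c → False := by
    intro x y z hxy hyz hx hy hz
    have h := hg.lt_on_openSegment (Set.mem_univ x) (Set.mem_univ z) (hxy.trans hyz).ne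
      (z := y) (by rw [openSegment_eq_Ioo (hxy.trans hyz)]; exact ⟨hxy, hyz⟩)
    simp [hx, hy, hz] at h
  by_cases hs : {x | g x = c}.Subsingleton
  · exact hs.countable
  · obtain ⟨a, ha, b, hb, hab⟩ := Set.not_subsingleton_iff.1 hs |>.exists_lt
    refine (Set.toFinite {a, b}).countable.mono fun x hx => ?_
    by_contra hne
    simp only [Set.mem_insert_iff, Set.mem_singleton_iff, not_or] at hne
    rcases lt_or_gt_of_ne hne.1 with h | h
    · exact key x a b h hab hx ha hb
    rcases lt_or_gt_of_ne hne.2 with h' | h'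
    · exact key a x b h h' ha hx hb
    · exact key a b x hab h' ha hb hx

end Coverage

/-! ### Confidence regions and the focal point -/

section Regions

variable {σ : ℝ} {π : Measure ℝ}

lemma logRatio_eq (σ : ℝ) (π : Measure ℝ) (θ y : ℝ) :
    logRatio σ π θ y = Real.log (ratio σ π θ y) := rfl

lemma continuous_logRatio (hσ : 0 < σ) (hπ : IsAdmissiblePrior σ π) (θ : ℝ) :
    Continuous (logRatio σ π θ) := by
  simp only [funext (logRatio_eq σ π θ)]
  exact ((continuous_ratio hσ hπ).comp (Continuous.prodMk_right θ)).log
    fun y => (ratio_pos hσ hπ θ y).ne'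

lemma logRatio_lt_iff (hσ : 0 < σ) (hπ : IsAdmissiblePrior σ π) (θ x y : ℝ) :
    logRatio σ π θ x < logRatio σ π θ y ↔ ratio σ π θ x < ratio σ π θ y :=
  Real.log_lt_log_iff (ratio_pos hσ hπ θ x) (ratio_pos hσ hπ θ y)

lemma isOpenPosMeasure_gaussianReal (θ : ℝ) {v : ℝ≥0} (hv : v ≠ 0) :
    (gaussianReal θ v).IsOpenPosMeasure :=
  (gaussianReal_absolutelyContinuous' θ hv).isOpenPosMeasure

lemma gaussianReal_logRatio_level (hσ : 0 < σ) (hπ : IsAdmissiblePrior σ π) (θ c : ℝ) :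
    gaussianReal θ (variance σ) {y | logRatio σ π θ y = c} = 0 := by
  have := nullSingletonClass_gaussianReal (μ := θ) (variance_ne_zero hσ)
  refine ((countable_level_of_strictConvexOn (strictConvexOn_ratio hσ hπ θ)
    (Real.exp c)).mono fun y hy => ?_).measure_zero _
  rw [Set.mem_ofPred_eq, ← (show _ = c from hy), logRatio_eq, Real.exp_log (ratio_pos hσ hπ θ y)]

lemma one_sub_mem_Ioo {α : ℝ} (hα : α ∈ Set.Ioo (0 : ℝ) 1) : 1 - α ∈ Set.Ioo (0 : ℝ) 1 :=
  ⟨by linarith [hα.2], by linarith [hα.1]⟩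

lemma exactThresholds_eq_singleton (hσ : 0 < σ) (hπ : IsAdmissiblePrior σ π) {α : ℝ}
    (hα : α ∈ Set.Ioo (0 : ℝ) 1) (θ : ℝ) :
    exactThresholds σ π α θ = {threshold σ π α θ} := by
  have := isOpenPosMeasure_gaussianReal θ (variance_ne_zero hσ)
  obtain ⟨k, hk⟩ := exists_measureReal_sublevel_eq (continuous_logRatio hσ hπ θ)
    (gaussianReal_logRatio_level hσ hπ θ) (one_sub_mem_Ioo hα)
  have h : exactThresholds σ π α θ = {k} := Set.eq_singleton_iff_unique_mem.2
    ⟨hk, fun c hc => sublevel_threshold_unique (continuous_logRatio hσ hπ θ)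
      (one_sub_mem_Ioo hα) hc hk⟩
  rw [threshold, h, csInf_singleton]

/-- The probability, under `Y = θ + U`, of a value of the likelihood ratio below the one at `y`. -/
noncomputable def lowerProb (σ : ℝ) (π : Measure ℝ) (θ y : ℝ) : ℝ :=
  (gaussianReal 0 (variance σ)).real {u | ratio σ π θ (θ + u) < ratio σ π θ y}

/-- Centring the noise at `0` makes the measure independent of `θ`, so that only the event varies
with the parameter. -/
lemma mem_confidenceRegion_iff (hσ : 0 < σ) (hπ : IsAdmissiblePrior σ π) {α : ℝ}
    (hα : α ∈ Set.Ioo (0 : ℝ) 1) (θ y : ℝ) :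
    θ ∈ confidenceRegion σ π α y ↔ lowerProb σ π θ y ≤ 1 - α := by
  have := isOpenPosMeasure_gaussianReal θ (variance_ne_zero hσ)
  have hk : threshold σ π α θ ∈ exactThresholds σ π α θ := by
    rw [exactThresholds_eq_singleton hσ hπ hα θ]
    rfl
  have hcont := continuous_logRatio hσ hπ θ
  change logRatio σ π θ y ≤ threshold σ π α θ ↔ _
  rw [le_threshold_iff hcont (one_sub_mem_Ioo hα) hk y, lowerProb]
  have hmap : gaussianReal θ (variance σ) = (gaussianReal 0 (variance σ)).map (θ + ·) := by
    rw [gaussianReal_map_const_add, zero_add]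
  rw [hmap, map_measureReal_apply (by fun_prop) (isOpen_lt hcont continuous_const).measurableSet]
  simp only [Set.preimage_ofPred_eq, logRatio_lt_iff hσ hπ]

/-- The measure of the slices of an open set is lower semicontinuous: a compact subset of one slice
carrying mass above `p` stays inside nearby slices, by the tube lemma. -/
lemma isOpen_lt_measureReal_slice {X Y : Type*} [TopologicalSpace X] [TopologicalSpace Y]
    [MeasurableSpace Y] [OpensMeasurableSpace Y] (μ : Measure Y) [IsFiniteMeasure μ] [μ.Regular]
    {S : Set (X × Y)} (hS : IsOpen S) {p : ℝ} (hp : 0 ≤ p) :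
    IsOpen {x | p < μ.real {y | (x, y) ∈ S}} := by
  rw [isOpen_iff_mem_nhds]
  intro x hx
  have hslice : IsOpen {y | (x, y) ∈ S} := hS.preimage (Continuous.prodMk_right x)
  obtain ⟨K, hKs, hK, hKlt⟩ := hslice.exists_lt_isCompact
    ((ENNReal.ofReal_lt_iff_lt_toReal hp (measure_ne_top μ _)).2 hx)
  obtain ⟨V, W, hV, -, hxV, hKW, hVW⟩ := generalized_tube_lemma (isCompact_singleton (x := x)) hK
    hS (by rintro ⟨a, y⟩ ⟨rfl, hy⟩; exact hKs hy)
  have hKlt' : p < μ.real K := (ENNReal.ofReal_lt_iff_lt_toReal hp (measure_ne_top μ _)).1 hKlt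
  filter_upwards [hV.mem_nhds (hxV rfl)] with t ht
  have hsub : K ⊆ {y | (t, y) ∈ S} := fun y hy => hVW (Set.mk_mem_prod ht (hKW hy))
  exact hKlt'.trans_le (measureReal_mono hsub)

lemma isClosed_confidenceRegion (hσ : 0 < σ) (hπ : IsAdmissiblePrior σ π) {α : ℝ}
    (hα : α ∈ Set.Ioo (0 : ℝ) 1) (y : ℝ) : IsClosed (confidenceRegion σ π α y) := by
  have hL := continuous_ratio hσ hπ
  have hopen : IsOpen {p : ℝ × ℝ | ratio σ π p.1 (p.1 + p.2) < ratio σ π p.1 y} :=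
    isOpen_lt (hL.comp (f := fun p : ℝ × ℝ => (p.1, p.1 + p.2)) (by fun_prop))
      (hL.comp (f := fun p : ℝ × ℝ => (p.1, y)) (by fun_prop))
  have heq : confidenceRegion σ π α y = {θ | 1 - α < lowerProb σ π θ y}ᶜ := by
    ext θ
    rw [mem_confidenceRegion_iff hσ hπ hα, Set.mem_compl_iff, Set.mem_ofPred_eq, not_lt]
  rw [heq, isClosed_compl_iff]
  exact isOpen_lt_measureReal_slice (gaussianReal 0 (variance σ)) hopen (one_sub_mem_Ioo hα).1.le

lemma lowerProb_eq_zero_iff (hσ : 0 < σ) (hπ : IsAdmissiblePrior σ π) (θ y : ℝ) :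
    lowerProb σ π θ y = 0 ↔ ∀ x, ratio σ π θ y ≤ ratio σ π θ x := by
  have := isOpenPosMeasure_gaussianReal 0 (variance_ne_zero hσ)
  have hL := continuous_ratio hσ hπ
  have hopen : IsOpen {u | ratio σ π θ (θ + u) < ratio σ π θ y} :=
    isOpen_lt (hL.comp (f := fun u : ℝ => (θ, θ + u)) (by fun_prop)) continuous_const
  rw [lowerProb, measureReal_eq_zero_iff, hopen.measure_eq_zero_iff (gaussianReal 0 (variance σ)),
    Set.eq_empty_iff_forall_notMem]
  refine ⟨fun h x => ?_, fun h u => not_lt.2 (h _)⟩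
  have := h (x - θ)
  simpa using this

lemma mem_focalSet_iff (hσ : 0 < σ) (hπ : IsAdmissiblePrior σ π) (θ y : ℝ) :
    θ ∈ focalSet σ π y ↔ ∀ x, ratio σ π θ y ≤ ratio σ π θ x := by
  rw [← lowerProb_eq_zero_iff hσ hπ, focalSet, Set.mem_iInter₂]
  constructor
  · intro h
    refine le_antisymm (le_of_forall_pos_le_add fun ε hε => ?_) measureReal_nonneg
    -- The level tends to `1` with `ε`; the cap `1 / 2` keeps it positive.
    have hα : 1 - min ε (1 / 2) ∈ Set.Ioo (0 : ℝ) 1 :=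
      ⟨by linarith [min_le_right ε (1 / 2)], by linarith [lt_min hε one_half_pos]⟩
    have := (mem_confidenceRegion_iff hσ hπ hα θ y).1 (h _ hα)
    linarith [min_le_left ε (1 / 2)]
  · intro h α hα
    rw [mem_confidenceRegion_iff hσ hπ hα, h]
    exact (one_sub_mem_Ioo hα).1.le

/-- The focal point is the posterior mean, in the form given by Tweedie's formula. -/
lemma focalSet_eq_singleton (hσ : 0 < σ) (hπ : IsAdmissiblePrior σ π) (y : ℝ) :
    focalSet σ π y = {y + σ ^ 2 * (deriv (marginal σ π) y / marginal σ π y)} := by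
  ext θ
  have hf := hπ.marginal_pos' hσ y
  have hderiv : HasDerivAt (ratio σ π θ) (√(2 * Real.pi * σ ^ 2) *
      (deriv (marginal σ π) y * Real.exp ((y - θ) ^ 2 / (2 * σ ^ 2)) +
      marginal σ π y * (Real.exp ((y - θ) ^ 2 / (2 * σ ^ 2)) *
        (2 * (y - θ) / (2 * σ ^ 2))))) y := by
    simp only [funext (ratio_eq σ π θ)]
    refine ((differentiable_marginal hσ hπ y).hasDerivAt.mul (HasDerivAt.exp ?_)).const_mul _
    have := (((hasDerivAt_id y).sub_const θ).pow 2).div_const (2 * σ ^ 2)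
    simpa using this
  have hzero : √(2 * Real.pi * σ ^ 2) *
      (deriv (marginal σ π) y * Real.exp ((y - θ) ^ 2 / (2 * σ ^ 2)) +
      marginal σ π y * (Real.exp ((y - θ) ^ 2 / (2 * σ ^ 2)) *
        (2 * (y - θ) / (2 * σ ^ 2)))) = 0 ↔
      θ = y + σ ^ 2 * (deriv (marginal σ π) y / marginal σ π y) := by
    have hs : √(2 * Real.pi * σ ^ 2) ≠ 0 := by positivity
    have he := (Real.exp_pos ((y - θ) ^ 2 / (2 * σ ^ 2))).ne'
    rw [mul_eq_zero_iff_left hs]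
    have : deriv (marginal σ π) y * Real.exp ((y - θ) ^ 2 / (2 * σ ^ 2)) +
      marginal σ π y * (Real.exp ((y - θ) ^ 2 / (2 * σ ^ 2)) * (2 * (y - θ) / (2 * σ ^ 2))) =
      Real.exp ((y - θ) ^ 2 / (2 * σ ^ 2)) * (marginal σ π y / σ ^ 2) *
        (y + σ ^ 2 * (deriv (marginal σ π) y / marginal σ π y) - θ) := by
      field_simp
      ring
    rw [this, mul_eq_zero_iff_left (by positivity), sub_eq_zero, eq_comm]
  rw [mem_focalSet_iff hσ hπ, Set.mem_singleton_iff, ← hzero]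
  constructor
  · intro h
    exact IsLocalMin.hasDerivAt_eq_zero (Filter.Eventually.of_forall h) hderiv
  · intro h x
    rw [h] at hderiv
    exact (strictConvexOn_ratio hσ hπ θ).convexOn.isMinOn_of_rightDeriv_eq_zero (by simp)
      (hderiv.hasDerivWithinAt.derivWithin (uniqueDiffWithinAt_Ioi y)) (Set.mem_univ x)

lemma focalSet_eq (hσ : 0 < σ) (hπ : IsAdmissiblePrior σ π) (y : ℝ) :
    focalSet σ π y = {focalPoint σ π y} :=
  Classical.epsilon_spec (p := fun t => focalSet σ π y = {t})
    ⟨_, focalSet_eq_singleton hσ hπ y⟩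

end Regions

/-! ### Normal quantiles and the mass of symmetric intervals -/

section Quantile

lemma strictMono_cdf {P : Measure ℝ} [IsProbabilityMeasure P] [P.IsOpenPosMeasure] :
    StrictMono (cdf P) := by
  intro x y hxy
  have hpos : 0 < P.real (Set.Ioo x y) :=
    ENNReal.toReal_pos (isOpen_Ioo.measure_pos P (Set.nonempty_Ioo.2 hxy)).ne' (measure_ne_top P _)
  have hdisj : Disjoint (Set.Iic x) (Set.Ioo x y) :=
    Set.disjoint_left.2 fun t ht ht' => ht'.1.not_ge ht
  have hle : P.real (Set.Iic x ∪ Set.Ioo x y) ≤ P.real (Set.Iic y) := measureReal_mono (by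
    rintro t (ht | ht)
    · exact le_trans ht hxy.le
    · exact ht.2.le)
  rw [measureReal_union hdisj measurableSet_Ioo] at hle
  rw [cdf_eq_real, cdf_eq_real]
  linarith

lemma cdf_normalQuantile {p : ℝ} (hp : p ∈ Set.Ioo (0 : ℝ) 1) :
    cdf (gaussianReal 0 1) (normalQuantile p) = p := by
  have := nullSingletonClass_gaussianReal (μ := 0) one_ne_zero
  have := isOpenPosMeasure_gaussianReal 0 one_ne_zero
  obtain ⟨x, hx⟩ := exists_cdf_eq (P := gaussianReal 0 1) hp
  have hset : {t | p ≤ cdf (gaussianReal 0 1) t} = Set.Ici x := by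
    ext t
    rw [Set.mem_ofPred_eq, ← hx, strictMono_cdf.le_iff_le, Set.mem_Ici]
  rw [normalQuantile, hset, csInf_Ici, hx]

lemma cdf_gaussianReal_neg (x : ℝ) :
    cdf (gaussianReal 0 1) (-x) = 1 - cdf (gaussianReal 0 1) x := by
  have := nullSingletonClass_gaussianReal (μ := 0) one_ne_zero
  have hmap : (gaussianReal 0 1).map (fun x => -x) = gaussianReal 0 1 := by
    rw [gaussianReal_map_neg, neg_zero]
  have hpre : (fun t : ℝ => -t) ⁻¹' Set.Iic (-x) = Set.Ici x := by
    ext t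
    simp
  have hcompl : (gaussianReal 0 1).real (Set.Ioi x) = 1 - (gaussianReal 0 1).real (Set.Iic x) := by
    rw [← Set.compl_Iic, probReal_compl_eq_one_sub measurableSet_Iic]
  rw [cdf_eq_real, cdf_eq_real, ← hcompl, measureReal_congr Ioi_ae_eq_Ici]
  conv_lhs => rw [← hmap]
  rw [map_measureReal_apply measurable_neg measurableSet_Iic, hpre]

lemma normalQuantile_pos {p : ℝ} (hp : p ∈ Set.Ioo (1 / 2 : ℝ) 1) : 0 < normalQuantile p := by
  have := isOpenPosMeasure_gaussianReal 0 one_ne_zero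
  rw [← (strictMono_cdf (P := gaussianReal 0 1)).lt_iff_lt,
    cdf_normalQuantile ⟨by linarith [hp.1], hp.2⟩]
  have := cdf_gaussianReal_neg 0
  rw [neg_zero] at this
  linarith [hp.1]

variable {σ α : ℝ}

lemma quantile_arg_mem (hα : α ∈ Set.Ioo (0 : ℝ) 1) : 1 - α / 2 ∈ Set.Ioo (1 / 2 : ℝ) 1 :=
  ⟨by linarith [hα.2], by linarith [hα.1]⟩

lemma gaussianReal_zInterval (hσ : 0 < σ) (hα : α ∈ Set.Ioo (0 : ℝ) 1) :
    (gaussianReal 0 (variance σ)).real (zInterval σ α) = 1 - α := by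
  have := nullSingletonClass_gaussianReal (μ := 0) one_ne_zero
  set z := normalQuantile (1 - α / 2) with hz
  have hzpos : 0 < z := normalQuantile_pos (quantile_arg_mem hα)
  have hmap : (gaussianReal 0 1).map (σ * ·) = gaussianReal 0 (variance σ) := by
    rw [gaussianReal_map_const_mul, mul_zero, mul_one]
    rfl
  have hpre : (σ * ·) ⁻¹' zInterval σ α = Set.Icc (-z) z := by
    ext t
    rw [zInterval, ← hz, Set.mem_preimage, Set.mem_Icc, Set.mem_Icc, mul_le_mul_iff_right₀ hσ,
      ← mul_neg, mul_le_mul_iff_right₀ hσ]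
  rw [← hmap, map_measureReal_apply (by fun_prop) (by exact measurableSet_Icc), hpre,
    ← measureReal_congr Ioc_ae_eq_Icc]
  have hunion : Set.Iic (-z) ∪ Set.Ioc (-z) z = Set.Iic z :=
    Set.Iic_union_Ioc_eq_Iic (by linarith)
  have hdisj : Disjoint (Set.Iic (-z)) (Set.Ioc (-z) z) :=
    Set.disjoint_left.2 fun t ht ht' => ht'.1.not_ge ht
  have h1 := measureReal_union (μ := gaussianReal 0 1) hdisj measurableSet_Ioc
  have h2 := cdf_gaussianReal_neg z
  have h3 : cdf (gaussianReal 0 1) z = 1 - α / 2 :=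
    cdf_normalQuantile ⟨by linarith [hα.2], by linarith [hα.1]⟩
  rw [hunion, ← cdf_eq_real, ← cdf_eq_real] at h1
  linarith

lemma lt_gaussianReal_Icc (hσ : 0 < σ) (hα : α ∈ Set.Ioo (0 : ℝ) 1) {r : ℝ}
    (hr : σ * normalQuantile (1 - α / 2) < r) :
    1 - α < (gaussianReal 0 (variance σ)).real (Set.Icc (-r) r) := by
  have := isOpenPosMeasure_gaussianReal 0 (variance_ne_zero hσ)
  have hz := gaussianReal_zInterval hσ hα
  have hzpos := mul_pos hσ (normalQuantile_pos (quantile_arg_mem hα))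
  set c := σ * normalQuantile (1 - α / 2)
  have hpos : 0 < (gaussianReal 0 (variance σ)).real (Set.Ioo c r) :=
    ENNReal.toReal_pos (isOpen_Ioo.measure_pos _ (Set.nonempty_Ioo.2 hr)).ne' (measure_ne_top _ _)
  have hdisj : Disjoint (zInterval σ α) (Set.Ioo c r) :=
    Set.disjoint_left.2 fun t ht ht' => ht'.1.not_ge ht.2
  have hle : (gaussianReal 0 (variance σ)).real (zInterval σ α ∪ Set.Ioo c r) ≤
      (gaussianReal 0 (variance σ)).real (Set.Icc (-r) r) := measureReal_mono (by
    rintro t (ht | ht)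
    · exact ⟨by linarith [ht.1], by linarith [ht.2]⟩
    · exact ⟨by linarith [ht.1], by linarith [ht.2]⟩)
  rw [measureReal_union hdisj measurableSet_Ioo, hz] at hle
  linarith

end Quantile

/-! ### Tail asymptotics and convergence of the focal point -/

section Tails

variable {σ : ℝ} {π : Measure ℝ} {f : ℝ → ℝ}

lemma tendsto_const_div_cocompact (h : ℝ) :
    Tendsto (fun y : ℝ => h / y) (cocompact ℝ) (𝓝 0) := by
  have : Tendsto (fun y : ℝ => y⁻¹) (cocompact ℝ) (𝓝 0) := by
    rw [← Metric.cobounded_eq_cocompact]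
    exact tendsto_inv₀_cobounded
  simpa [div_eq_mul_inv] using this.const_mul h

lemma eventually_ne_cocompact (a : ℝ) : ∀ᶠ y in cocompact ℝ, y ≠ a :=
  (isCompact_singleton (x := a)).compl_mem_cocompact

lemma tendsto_add_const_cocompact (h : ℝ) :
    Tendsto (fun y : ℝ => y + h) (cocompact ℝ) (cocompact ℝ) :=
  (Homeomorph.addRight h).isClosedEmbedding.tendsto_cocompact

lemma HasTails.exists_tendsto_cocompact (hf : HasTails σ 0 f) :
    ∃ δ γ : ℝ, 0 < γ ∧
      Tendsto (fun y => f y / (γ * |y| ^ (-δ))) (cocompact ℝ) (𝓝 1) := by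
  obtain ⟨δ, γ, -, hγ, htop, hbot⟩ := hf
  refine ⟨δ, γ, hγ, ?_⟩
  rw [cocompact_eq_atBot_atTop, tendsto_sup]
  exact ⟨by simpa using hbot, by simpa using htop⟩

/-- A function with polynomial tails is asymptotically translation invariant. -/
lemma HasTails.tendsto_translate_div (hf : HasTails σ 0 f) (hpos : ∀ y, 0 < f y) (h : ℝ) :
    Tendsto (fun y => f (y + h) / f y) (cocompact ℝ) (𝓝 1) := by
  obtain ⟨δ, γ, hγ, hq⟩ := hf.exists_tendsto_cocompact
  have h1 : Tendsto (fun y : ℝ => |1 + h / y| ^ (-δ)) (cocompact ℝ) (𝓝 1) := by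
    have := ((tendsto_const_div_cocompact h).const_add 1).abs
    rw [add_zero, abs_one] at this
    simpa using this.rpow_const (p := -δ) (Or.inl one_ne_zero)
  have h2 := (((hq.comp (tendsto_add_const_cocompact h)).div hq one_ne_zero).mul h1)
  rw [div_one, mul_one] at h2
  refine h2.congr' ?_
  filter_upwards [eventually_ne_cocompact 0, eventually_ne_cocompact (-h)] with y hy hyh
  have hyh' : y + h ≠ 0 := fun hh => hyh (by linarith)
  have e : |1 + h / y| = |y + h| / |y| := by
    rw [← abs_div]
    congr 1
    field_simp
  have a1 : 0 < |y| ^ (-δ) := Real.rpow_pos_of_pos (abs_pos.2 hy) _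
  have a2 : 0 < |y + h| ^ (-δ) := Real.rpow_pos_of_pos (abs_pos.2 hyh') _
  have := (hpos y).ne'
  simp only [Pi.div_apply, Function.comp]
  rw [e, Real.div_rpow (abs_nonneg _) (abs_nonneg _)]
  field_simp

/-- A crude lower bound on the decay of `f`, enough because a Gaussian factor grows faster than `exp
|y|`. -/
lemma HasTails.tendsto_mul_exp_abs (hf : HasTails σ 0 f) :
    Tendsto (fun y => f y * Real.exp |y|) (cocompact ℝ) atTop := by
  obtain ⟨δ, γ, hγ, hq⟩ := hf.exists_tendsto_cocompact
  have h0 : Tendsto (fun y : ℝ => |y| ^ δ * Real.exp (-|y|)) (cocompact ℝ) (𝓝[>] 0) := by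
    refine tendsto_nhdsWithin_iff.2 ⟨?_, ?_⟩
    · have := tendsto_rpow_mul_exp_neg_mul_atTop_nhds_zero δ 1 one_pos
      refine (this.comp (tendsto_norm_cocompact_atTop (E := ℝ))).congr fun y => ?_
      simp
    · filter_upwards [eventually_ne_cocompact 0] with y hy
      exact mul_pos (Real.rpow_pos_of_pos (abs_pos.2 hy) _) (Real.exp_pos _)
  have h1 := hq.pos_mul_atTop one_pos ((tendsto_inv_nhdsGT_zero.comp h0).const_mul_atTop hγ)
  refine h1.congr' ?_
  filter_upwards [eventually_ne_cocompact 0] with y hy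
  have a1 : 0 < |y| ^ δ := Real.rpow_pos_of_pos (abs_pos.2 hy) _
  simp only [Function.comp, Real.exp_neg, Real.rpow_neg (abs_nonneg y)]
  field_simp

lemma ratio_translate_div (hσ : 0 < σ) (hπ : IsAdmissiblePrior σ π) (θ u : ℝ) :
    ratio σ π θ (θ + u) / ratio σ π θ θ =
      marginal σ π (θ + u) / marginal σ π θ * Real.exp (u ^ 2 / (2 * σ ^ 2)) := by
  have := (hπ.marginal_pos' hσ θ).ne'
  rw [ratio_eq, ratio_eq, add_sub_cancel_left, sub_self]
  have hs : √(2 * Real.pi * σ ^ 2) ≠ 0 := by positivity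
  field_simp
  simp

/-- After division by the value at `θ`, the two sides tend to `exp(u² / (2σ²))` and `exp(v² /
(2σ²))`. -/
lemma eventually_ratio_lt (hσ : 0 < σ) (hπ : IsAdmissiblePrior σ π)
    (htails : HasTails σ 0 (marginal σ π)) {u v : ℝ} (huv : |u| < |v|) :
    ∀ᶠ θ in cocompact ℝ, ratio σ π θ (θ + u) < ratio σ π θ (θ + v) := by
  have hlim : ∀ w, Tendsto (fun θ => ratio σ π θ (θ + w) / ratio σ π θ θ) (cocompact ℝ)
      (𝓝 (Real.exp (w ^ 2 / (2 * σ ^ 2)))) := by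
    intro w
    simp only [ratio_translate_div hσ hπ]
    simpa using (htails.tendsto_translate_div (hπ.marginal_pos' hσ) w).mul_const
      (Real.exp (w ^ 2 / (2 * σ ^ 2)))
  have hlt : Real.exp (u ^ 2 / (2 * σ ^ 2)) < Real.exp (v ^ 2 / (2 * σ ^ 2)) := by
    have := sq_lt_sq.2 huv
    gcongr
  filter_upwards [(hlim u).eventually_lt (hlim v) hlt] with θ hθ
  exact (div_lt_div_iff_of_pos_right (ratio_pos hσ hπ θ θ)).1 hθ

lemma tendsto_focalPoint_sub (hσ : 0 < σ) (hπ : IsAdmissiblePrior σ π)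
    (htails : HasTails σ 0 (marginal σ π)) :
    Tendsto (fun y => focalPoint σ π y - y) (cocompact ℝ) (𝓝 0) := by
  have key : ∀ h : ℝ, h ≠ 0 → ∀ᶠ y in cocompact ℝ, h * (focalPoint σ π y - y) < h ^ 2 := by
    intro h hh
    have hone : (1 : ℝ) < Real.exp (h ^ 2 / (2 * σ ^ 2)) := Real.one_lt_exp_iff.2 (by positivity)
    filter_upwards [(htails.tendsto_translate_div (hπ.marginal_pos' hσ) h).eventually_lt_const
      hone] with y hy
    set θ := focalPoint σ π y
    have hmem : θ ∈ focalSet σ π y := by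
      rw [focalSet_eq hσ hπ y]
      rfl
    have hmin := (mem_focalSet_iff hσ hπ θ y).1 hmem (y + h)
    rw [ratio_eq, ratio_eq, mul_le_mul_iff_right₀ (by positivity)] at hmin
    rw [div_lt_iff₀ (hπ.marginal_pos' hσ y)] at hy
    have h1 : marginal σ π y * Real.exp ((y - θ) ^ 2 / (2 * σ ^ 2)) <
        marginal σ π y * (Real.exp (h ^ 2 / (2 * σ ^ 2)) *
          Real.exp ((y + h - θ) ^ 2 / (2 * σ ^ 2))) := by
      refine hmin.trans_lt ?_
      have := mul_lt_mul_of_pos_right hy (Real.exp_pos ((y + h - θ) ^ 2 / (2 * σ ^ 2)))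
      linarith
    -- With `d = θ - y`, comparing exponents gives `d² < h² + (h - d)²`, that is `h d < h²`.
    rw [mul_lt_mul_iff_right₀ (hπ.marginal_pos' hσ y), ← Real.exp_add, Real.exp_lt_exp, ← add_div,
      div_lt_div_iff_of_pos_right (by positivity)] at h1
    nlinarith
  rw [Metric.tendsto_nhds]
  intro ε hε
  filter_upwards [key ε hε.ne', key (-ε) (neg_ne_zero.2 hε.ne')] with y h1 h2
  rw [Real.dist_eq, sub_zero, abs_lt]
  constructor <;> nlinarith

end Tails

/-! ### Hausdorff convergence of the confidence regions -/

section Convergence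

/-- Convexity bounds `g y` by its values at `θ ± r`. A sublevel point beyond `θ ± r'` would put one
of these between itself and `y`, forcing `g` there to be at most `g y`. -/
lemma sublevel_subset_Icc_of_convexOn {g : ℝ → ℝ} (hg : ConvexOn ℝ Set.univ g) {θ r r' : ℝ}
    (hrr : r < r') (h₁ : g (θ + r) < g (θ + r')) (h₂ : g (θ + -r) < g (θ + r'))
    (h₃ : g (θ + r) < g (θ + -r')) (h₄ : g (θ + -r) < g (θ + -r')) {y : ℝ} (hy : |θ - y| ≤ r) :
    {u | g (θ + u) < g y} ⊆ Set.Icc (-r') r' := by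
  intro u (hu : g (θ + u) < g y)
  obtain ⟨hy₁, hy₂⟩ := abs_le.1 hy
  have hq : ∀ {a b c : ℝ}, a ≤ b → b ≤ c → g b ≤ max (g a) (g c) := fun hab hbc =>
    hg.le_max_of_mem_Icc (Set.mem_univ _) (Set.mem_univ _) ⟨hab, hbc⟩
  have hyr : g y ≤ max (g (θ + -r)) (g (θ + r)) := hq (by linarith) (by linarith)
  by_contra hmem
  rw [Set.mem_Icc, not_and_or, not_le, not_le] at hmem
  rcases hmem with hlt | hlt
  · have h5 : g (θ + -r') ≤ max (g (θ + u)) (g y) := hq (by linarith) (by linarith)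
    rw [max_eq_right hu.le] at h5
    exact ((h5.trans hyr).trans_lt (max_lt h₄ h₃)).false
  · have h5 : g (θ + r') ≤ max (g y) (g (θ + u)) := hq (by linarith) (by linarith)
    rw [max_eq_left hu.le] at h5
    exact ((h5.trans hyr).trans_lt (max_lt h₂ h₁)).false

/-- On the side of `y`, the point at distance `r` lies between `y` and the point at distance `r'`.
Since `g` increases from the latter to the former, quasiconvexity makes `g y` at least the value at
distance `r`. -/
lemma Icc_subset_sublevel_of_convexOn {g : ℝ → ℝ} (hg : ConvexOn ℝ Set.univ g) {θ r r' : ℝ}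
    (hrr : r' < r) (h₁ : g (θ + r') < g (θ + r)) (h₂ : g (θ + -r') < g (θ + r))
    (h₃ : g (θ + r') < g (θ + -r)) (h₄ : g (θ + -r') < g (θ + -r)) {y : ℝ} (hy : r ≤ |θ - y|) :
    Set.Icc (-r') r' ⊆ {u | g (θ + u) < g y} := by
  intro u hu
  have hq : ∀ {a b c : ℝ}, a ≤ b → b ≤ c → g b ≤ max (g a) (g c) := fun hab hbc =>
    hg.le_max_of_mem_Icc (Set.mem_univ _) (Set.mem_univ _) ⟨hab, hbc⟩
  have hur : g (θ + u) ≤ max (g (θ + -r')) (g (θ + r')) :=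
    hq (by linarith [hu.1]) (by linarith [hu.2])
  change g (θ + u) < g y
  rcases le_abs'.1 hy with hle | hle
  · have h5 : g (θ + r) ≤ max (g (θ + r')) (g y) := hq (by linarith) (by linarith)
    exact (hur.trans_lt (max_lt h₂ h₁)).trans_le ((le_max_iff.1 h5).resolve_left h₁.not_ge)
  · have h5 : g (θ + -r) ≤ max (g y) (g (θ + -r')) := hq (by linarith) (by linarith)
    exact (hur.trans_lt (max_lt h₄ h₃)).trans_le ((le_max_iff.1 h5).resolve_right h₄.not_ge)

lemma hausdorffEDist_Icc_le {s : Set ℝ} {c ε : ℝ} (hε : 0 < ε) (hεc : ε < c)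
    (h₁ : Set.Icc (-(c - ε)) (c - ε) ⊆ s) (h₂ : s ⊆ Set.Icc (-(c + ε)) (c + ε)) :
    Metric.hausdorffEDist s (Set.Icc (-c) c) ≤ ENNReal.ofReal ε := by
  have hproj : ∀ {a b x : ℝ}, 0 ≤ a → b ≤ a + ε → x ∈ Set.Icc (-b) b →
      ∃ y ∈ Set.Icc (-a) a, edist x y ≤ ENNReal.ofReal ε := by
    intro a b x ha hb hx
    -- The witness is the projection of `x` onto `[-a, a]`.
    refine ⟨max (-a) (min x a), ⟨le_max_left _ _, max_le (by linarith) (min_le_right _ _)⟩, ?_⟩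
    rw [edist_dist, Real.dist_eq]
    refine ENNReal.ofReal_le_ofReal (abs_le.2 ⟨?_, ?_⟩)
    · rcases le_total (-a) (min x a) with h | h
      · rw [max_eq_right h]; linarith [min_le_left x a]
      · rw [max_eq_left h]; linarith [hx.1]
    · rcases le_total x a with h | h
      · rw [min_eq_left h]; linarith [le_max_right (-a) x]
      · rw [min_eq_right h]; linarith [le_max_right (-a) a, hx.2]
  refine Metric.hausdorffEDist_le_of_mem_edist (fun x hx => ?_) (fun x hx => ?_)
  · exact hproj (by linarith) le_rfl (h₂ hx)
  · obtain ⟨y, hy, hxy⟩ := hproj (a := c - ε) (by linarith) (by linarith) hx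
    exact ⟨y, h₁ hy, hxy⟩

variable {σ : ℝ} {π : Measure ℝ} {α : ℝ}

lemma eventually_lowerProb_le (hσ : 0 < σ) (hπ : IsAdmissiblePrior σ π)
    (htails : HasTails σ 0 (marginal σ π)) (hα : α ∈ Set.Ioo (0 : ℝ) 1) {r : ℝ} (hr : 0 ≤ r)
    (hrc : r < σ * normalQuantile (1 - α / 2)) :
    ∀ᶠ θ in cocompact ℝ, ∀ y, |θ - y| ≤ r → lowerProb σ π θ y ≤ 1 - α := by
  have habs : |r| < |σ * normalQuantile (1 - α / 2)| := by
    rwa [abs_of_nonneg hr, abs_of_pos (hr.trans_lt hrc)]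
  have hev : ∀ {u v : ℝ}, |u| < |v| →
      ∀ᶠ θ in cocompact ℝ, ratio σ π θ (θ + u) < ratio σ π θ (θ + v) :=
    fun h => eventually_ratio_lt hσ hπ htails h
  filter_upwards [hev habs, hev ((abs_neg r).trans_lt habs),
    hev (habs.trans_eq (abs_neg _).symm),
    hev ((abs_neg r).trans_lt (habs.trans_eq (abs_neg _).symm))] with θ h₁ h₂ h₃ h₄ y hy
  rw [← gaussianReal_zInterval hσ hα]
  exact measureReal_mono (sublevel_subset_Icc_of_convexOn (strictConvexOn_ratio hσ hπ θ).convexOn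
    hrc h₁ h₂ h₃ h₄ hy)

lemma eventually_lt_lowerProb (hσ : 0 < σ) (hπ : IsAdmissiblePrior σ π)
    (htails : HasTails σ 0 (marginal σ π)) (hα : α ∈ Set.Ioo (0 : ℝ) 1) {r : ℝ}
    (hrc : σ * normalQuantile (1 - α / 2) < r) :
    ∀ᶠ θ in cocompact ℝ, ∀ y, r ≤ |θ - y| → 1 - α < lowerProb σ π θ y := by
  obtain ⟨r', hcr', hr'⟩ := exists_between hrc
  have hc := mul_pos hσ (normalQuantile_pos (quantile_arg_mem hα))
  have habs : |r'| < |r| := by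
    rwa [abs_of_pos (hc.trans hcr'), abs_of_pos (hc.trans hrc)]
  have hev : ∀ {u v : ℝ}, |u| < |v| →
      ∀ᶠ θ in cocompact ℝ, ratio σ π θ (θ + u) < ratio σ π θ (θ + v) :=
    fun h => eventually_ratio_lt hσ hπ htails h
  filter_upwards [hev habs, hev ((abs_neg r').trans_lt habs),
    hev (habs.trans_eq (abs_neg _).symm),
    hev ((abs_neg r').trans_lt (habs.trans_eq (abs_neg _).symm))] with θ h₁ h₂ h₃ h₄ y hy
  exact (lt_gaussianReal_Icc hσ hα hcr').trans_le (measureReal_mono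
    (Icc_subset_sublevel_of_convexOn (strictConvexOn_ratio hσ hπ θ).convexOn hr' h₁ h₂ h₃ h₄ hy))

/-- Parameters from a bounded set are eventually rejected. -/
lemma eventually_forall_bounded_lt_lowerProb (hσ : 0 < σ) (hπ : IsAdmissiblePrior σ π)
    (htails : HasTails σ 0 (marginal σ π)) (hα : α ∈ Set.Ioo (0 : ℝ) 1) (T : ℝ) :
    ∀ᶠ y in cocompact ℝ, ∀ θ, |θ| ≤ T → 1 - α < lowerProb σ π θ y := by
  obtain ⟨r, hr⟩ := exists_gt (σ * normalQuantile (1 - α / 2))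
  have hcont : Continuous fun p : ℝ × ℝ => ratio σ π p.1 (p.1 + p.2) :=
    (continuous_ratio hσ hπ).comp (f := fun p : ℝ × ℝ => (p.1, p.1 + p.2)) (by fun_prop)
  obtain ⟨B, hB⟩ := ((isCompact_Icc (a := -T) (b := T)).prod
    (isCompact_Icc (a := -r) (b := r))).bddAbove_image hcont.continuousOn
  -- The constant comes from `(y - θ)² / (2σ²) ≥ |y - θ| - σ² / 2 ≥ |y| - T - σ² / 2`.
  have hs : 0 < √(2 * Real.pi * σ ^ 2) * Real.exp (-(T + σ ^ 2 / 2)) := by positivity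
  filter_upwards [(htails.tendsto_mul_exp_abs.const_mul_atTop hs).eventually_gt_atTop B]
    with y hy θ hθ
  refine (lt_gaussianReal_Icc hσ hα hr).trans_le (measureReal_mono fun u hu => ?_)
  have h1 : ratio σ π θ (θ + u) ≤ B :=
    hB ⟨(θ, u), Set.mk_mem_prod (abs_le.1 hθ) hu, rfl⟩
  refine (h1.trans_lt hy).trans_le ?_
  rw [ratio_eq, mul_assoc]
  have hquad : |y| - (T + σ ^ 2 / 2) ≤ (y - θ) ^ 2 / (2 * σ ^ 2) := by
    have h2 : |y| ≤ |y - θ| + |θ| := by simpa using abs_add_le (y - θ) θ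
    have h3 : |y - θ| - σ ^ 2 / 2 ≤ (y - θ) ^ 2 / (2 * σ ^ 2) := by
      rw [le_div_iff₀ (by positivity), ← sq_abs (y - θ)]
      nlinarith [sq_nonneg (|y - θ| - σ ^ 2)]
    linarith
  have hexp := Real.exp_le_exp.2 hquad
  rw [sub_eq_add_neg, Real.exp_add] at hexp
  have := mul_le_mul_of_nonneg_left hexp (hπ.marginal_pos' hσ y).le
  refine mul_le_mul_of_nonneg_left ?_ (Real.sqrt_nonneg _)
  linarith

lemma tendsto_hausdorffEDist_confidenceRegion (hσ : 0 < σ) (hπ : IsAdmissiblePrior σ π)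
    (htails : HasTails σ 0 (marginal σ π)) (hα : α ∈ Set.Ioo (0 : ℝ) 1) :
    Tendsto (fun y => Metric.hausdorffEDist (shiftBack (confidenceRegion σ π α y) y)
      (zInterval σ α)) (cocompact ℝ) (𝓝 0) := by
  have hc := mul_pos hσ (normalQuantile_pos (quantile_arg_mem hα))
  set c := σ * normalQuantile (1 - α / 2)
  have key : ∀ ε, 0 < ε → ε < c → ∀ᶠ y in cocompact ℝ,
      Metric.hausdorffEDist (shiftBack (confidenceRegion σ π α y) y) (zInterval σ α) ≤
        ENNReal.ofReal ε := by
    intro ε hε hεc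
    have hin := eventually_lowerProb_le hσ hπ htails hα (r := c - ε) (by linarith) (by linarith)
    have hout := eventually_lt_lowerProb hσ hπ htails hα (r := c + ε) (by linarith)
    have hboth := hin.and hout
    -- The acceptance and rejection estimates hold for large `|θ|`, while the limit is in `y`. A
    -- cutoff `T` on `|θ|` separates the bounded parameters, which are rejected for large `|y|`.
    rw [← Metric.cobounded_eq_cocompact, ← comap_norm_atTop, eventually_comap] at hboth
    obtain ⟨T, hT⟩ := eventually_atTop.1 hboth
    filter_upwards [eventually_forall_bounded_lt_lowerProb hσ hπ htails hα T,
      tendsto_norm_cocompact_atTop.eventually_ge_atTop (T + c)] with y hmid hy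
    rw [Real.norm_eq_abs] at hy
    refine hausdorffEDist_Icc_le hε hεc (fun x hx => ⟨x + y, ?_, by ring⟩) ?_
    · rw [mem_confidenceRegion_iff hσ hπ hα]
      have hx' : |x| ≤ c - ε := abs_le.2 hx
      refine (hT _ ?_ (x + y) rfl).1 y (by rwa [add_sub_cancel_right])
      have : |y| ≤ |x + y| + |x| := by simpa using abs_sub (x + y) x
      linarith [Real.norm_eq_abs (x + y)]
    · rintro _ ⟨θ, hθ, rfl⟩
      rw [mem_confidenceRegion_iff hσ hπ hα] at hθ
      have hθT : T ≤ |θ| := by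
        by_contra! h
        exact (hmid θ h.le).not_ge hθ
      refine abs_le.1 ?_
      by_contra! h
      exact ((hT |θ| hθT θ rfl).2 y h.le).not_ge hθ
  rw [ENNReal.tendsto_nhds_zero]
  intro ε hε
  obtain ⟨e, he, hee⟩ : ∃ e : ℝ, 0 < e ∧ ENNReal.ofReal e ≤ ε := by
    obtain ⟨e, he, hee⟩ := ENNReal.lt_iff_exists_nnreal_btwn.1 hε
    exact ⟨e, by exact_mod_cast he, by simpa using hee.le⟩
  -- Capping at `c / 2` keeps the inner interval nondegenerate.
  filter_upwards [key (min e (c / 2)) (by positivity) ((min_le_right _ _).trans_lt (by linarith))]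
    with y hy
  exact hy.trans ((ENNReal.ofReal_le_ofReal (min_le_left _ _)).trans hee)

end Convergence

end FAB

theorem mainTheorem4 (σ : ℝ) (hσ : 0 < σ) (π : Measure ℝ)
    (hπ : FAB.IsAdmissiblePrior σ π)
    (htails : FAB.HasTails σ 0 (FAB.marginal σ π)) :
    -- the procedure is well defined: the smallest threshold with exact coverage exists,
    -- and the intersection of the confidence regions is a single point
    (∀ α ∈ Set.Ioo (0 : ℝ) 1, ∀ θ₀ : ℝ,
      IsLeast (FAB.exactThresholds σ π α θ₀) (FAB.threshold σ π α θ₀)) ∧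
    (∀ y : ℝ, FAB.focalSet σ π y = {FAB.focalPoint σ π y}) ∧
    -- the influence of the prior on the focal point vanishes
    Tendsto (fun y => FAB.focalPoint σ π y - y) atTop (𝓝 0) ∧
    Tendsto (fun y => FAB.focalPoint σ π y - y) atBot (𝓝 0) ∧
    -- the confidence regions converge to the z-interval in Hausdorff distance
    (∀ α ∈ Set.Ioo (0 : ℝ) 1,
      (∀ y : ℝ, IsClosed (FAB.confidenceRegion σ π α y)) ∧
      Tendsto (fun y => Metric.hausdorffEDist
          (FAB.shiftBack (FAB.confidenceRegion σ π α y) y) (FAB.zInterval σ α))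
        atTop (𝓝 0) ∧
      Tendsto (fun y => Metric.hausdorffEDist
          (FAB.shiftBack (FAB.confidenceRegion σ π α y) y) (FAB.zInterval σ α))
        atBot (𝓝 0)) := by
  have hfocal := FAB.tendsto_focalPoint_sub hσ hπ htails
  rw [cocompact_eq_atBot_atTop, tendsto_sup] at hfocal
  refine ⟨fun α hα θ₀ => ?_, FAB.focalSet_eq hσ hπ, hfocal.2, hfocal.1, fun α hα => ?_⟩
  · rw [FAB.exactThresholds_eq_singleton hσ hπ hα]
    exact isLeast_singleton
  · have hregion := FAB.tendsto_hausdorffEDist_confidenceRegion hσ hπ htails hα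
    rw [cocompact_eq_atBot_atTop, tendsto_sup] at hregion
    exact ⟨FAB.isClosed_confidenceRegion hσ hπ hα, hregion.2, hregion.1⟩
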